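/- Let $X_1,\dots,X_n$ ($n\ge 0$) be nonempty proper metric spaces, each of which is $\mathrm{CAT}(-1)$, irreducible (not isometric to an $\ell^2$-product of two metric spaces each having more than one point) and minimal ($X_i$ has no nonempty proper closed convex subset invariant under $\mathrm{Isom}(X_i)$). Let $\Gamma$ be a group acting properly, cocompactly and by isometries on the $\ell^2$-product $X=\prod_{i=1}^n X_i$ without permuting isometric factors, that is, every $g\in\Gamma$ acts on $X$ as a product of isometries of the factors, $g\cdot(x_1,\dots,x_n)=(\varphi_{g,1}(x_1),\dots,\varphi_{g,n}(x_n))$ with $\varphi_{g,i}\in\mathrm{Isom}(X_i)$. Then $\Gamma$ is a hierarchically hyperbolic group. Here $\Gamma$ is a hierarchically hyperbolic group if it has a finite generating set whose Cayley graph carries a hierarchically hyperbolic space structure in the sense of Behrstock, Hagen and Sisto, with set of domains $\mathfrak S$, relations $\sqsubseteq,\bot,\pitchfork$ (nesting, orthogonality, transversality), uniformly hyperbolic geodesic spaces $\mathcal CU$, uniformly coarsely onto projections $\pi_U$ and relative projections $\rho^V_U$, together with an action of $\Gamma$ on $\mathfrak S$ with finitely many orbits which preserves the three relations, and isometries $g:\mathcal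 CU\to\mathcal C(gU)$ for $g\in\Gamma$, $U\in\mathfrak S$, satisfying $g\cdot h=gh$, such that $g\,\pi_U(x)=\pi_{gU}(gx)$ for all $g,x\in\Gamma$ and $U\in\mathfrak S$, and $g\,\rho^V_U=\rho^{gV}_{gU}$ whenever $U\pitchfork V$ or $V\sqsubsetneq U$. -/

import Mathlib

open Set

universe u v

namespace HierHyp

/-! ### Geodesics, hyperbolicity, CAT(-1) -/

/-- `γ`, restricted to `[0, dist x y]`, is a geodesic from `x` to `y`, parametrised by arc length. -/
def IsGeodesic {X : Type u} [MetricSpace X] (γ : ℝ → X) (x y : X) : Prop :=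
  γ 0 = x ∧ γ (dist x y) = y ∧
    ∀ s ∈ Icc 0 (dist x y), ∀ t ∈ Icc 0 (dist x y), dist (γ s) (γ t) = |s - t|

/-- Any two points are joined by a geodesic. -/
def IsGeodesicSpace (X : Type u) [MetricSpace X] : Prop :=
  ∀ x y : X, ∃ γ : ℝ → X, IsGeodesic γ x y

/-- A geodesic space all of whose geodesic triangles are `δ`-slim. -/
def IsHyperbolicSpace (X : Type u) [MetricSpace X] (δ : ℝ) : Prop :=
  IsGeodesicSpace X ∧
    ∀ (x y z : X) (α β γ : ℝ → X), IsGeodesic α x y → IsGeodesic β y z → IsGeodesic γ x z →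
      ∀ t ∈ Icc 0 (dist x y),
        (∃ s ∈ Icc 0 (dist y z), dist (α t) (β s) ≤ δ) ∨
        (∃ s ∈ Icc 0 (dist x z), dist (α t) (γ s) ≤ δ)

/-- `X` is a CAT(-1) space: it is geodesic and geodesic triangles are no thicker than their
comparison triangles in the hyperbolic plane (the upper half plane, of curvature `-1`).
Two points of a triangle that do not lie on the same side lie on two sides `[p, q]`, `[p, r]` with
a common vertex `p`; the comparison point of `α s ∈ [p, q]` is the point of `[p', q']` at
distance `s` from `p'`. -/
def IsCATNegOne (X : Type u) [MetricSpace X] : Prop :=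
  IsGeodesicSpace X ∧
    ∀ (p q r : X) (p' q' r' : UpperHalfPlane),
      dist p' q' = dist p q → dist q' r' = dist q r → dist p' r' = dist p r →
      ∀ (α β : ℝ → X) (α' β' : ℝ → UpperHalfPlane),
        IsGeodesic α p q → IsGeodesic β p r → IsGeodesic α' p' q' → IsGeodesic β' p' r' →
        ∀ s ∈ Icc 0 (dist p q), ∀ t ∈ Icc 0 (dist p r),
          dist (α s) (β t) ≤ dist (α' s) (β' t)

/-- Every geodesic with endpoints in `A` stays in `A`. -/
def IsGeodConvex {X : Type u} [MetricSpace X] (A : Set X) : Prop :=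
  ∀ x ∈ A, ∀ y ∈ A, ∀ γ : ℝ → X, IsGeodesic γ x y → ∀ t ∈ Icc 0 (dist x y), γ t ∈ A

/-- The full isometry group acts minimally: there is no nonempty proper closed convex invariant
subset. -/
def IsMinimalSpace (X : Type u) [MetricSpace X] : Prop :=
  ∀ A : Set X, A.Nonempty → IsClosed A → IsGeodConvex A → (∀ φ : X ≃ᵢ X, ∀ x ∈ A, φ x ∈ A) →
    A = univ

/-- `X` is not isometric to an (`ℓ²`) product of two metric spaces with more than one point. -/
def IsIrreducibleSpace (X : Type u) [MetricSpace X] : Prop :=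
  ∀ (Y Z : Type u) [MetricSpace Y] [MetricSpace Z],
    Nonempty (X ≃ᵢ WithLp 2 (Y × Z)) → Subsingleton Y ∨ Subsingleton Z

/-! ### Hierarchically hyperbolic spaces -/

/-- Any two points are joined by a `(q, q)`-quasigeodesic, for a uniform `q`. -/
def IsQuasigeodesicSpace (X : Type u) [MetricSpace X] : Prop :=
  ∃ q : ℝ, 1 ≤ q ∧ ∀ x y : X, ∃ (L : ℝ) (γ : ℝ → X), 0 ≤ L ∧ γ 0 = x ∧ γ L = y ∧
    ∀ s ∈ Icc 0 L, ∀ t ∈ Icc 0 L,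
      |s - t| / q - q ≤ dist (γ s) (γ t) ∧ dist (γ s) (γ t) ≤ q * |s - t| + q

/-- The distance `inf {dist a b | a ∈ A, b ∈ B}` between two (nonempty) sets. -/
noncomputable def setDist {X : Type u} [MetricSpace X] (A B : Set X) : ℝ :=
  sInf (image2 dist A B)

/-- The set `A` has diameter at most `r`. -/
def DiamLE {X : Type u} [MetricSpace X] (A : Set X) (r : ℝ) : Prop :=
  ∀ a ∈ A, ∀ b ∈ A, dist a b ≤ r

/-- A hierarchically hyperbolic structure on `X` with partially ordered set of domains `𝔖`
(`≤` is nesting, `<` is proper nesting) and associated hyperbolic spaces `C U`.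
All the constants of the axioms (except that of uniqueness, which is a function, and the
complexity) may be enlarged, so a single constant `ε` is used for them. -/
structure HHS (X : Type u) [MetricSpace X] (𝔖 : Type) [PartialOrder 𝔖]
    (C : 𝔖 → Type) [∀ U, MetricSpace (C U)] where
  /-- the uniform constant -/
  ε : ℝ
  /-- orthogonality -/
  orth : 𝔖 → 𝔖 → Prop
  /-- the projections -/
  π : ∀ U, X → Set (C U)
  /-- the set `ρ^V_W ⊆ C W`; meaningful when `V < W` or `V`, `W` are transverse -/
  ρ : ∀ _V W : 𝔖, Set (C W)
  /-- the map `ρ^W_V : C W → 2^{C V}`; meaningful when `V < W` -/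
  ρdown : ∀ W V : 𝔖, C W → Set (C V)
  one_le_ε : 1 ≤ ε
  quasigeodesic : IsQuasigeodesicSpace X
  hyperbolic : ∀ U, IsHyperbolicSpace (C U) ε
  -- projections
  π_nonempty : ∀ U x, (π U x).Nonempty
  π_diam : ∀ U x, DiamLE (π U x) ε
  π_lipschitz : ∀ U x y, setDist (π U x) (π U y) ≤ ε * dist x y + ε
  π_coarsely_onto : ∀ U (p : C U), ∃ x, ∃ a ∈ π U x, dist p a ≤ ε
  -- nesting
  exists_max : IsEmpty 𝔖 ∨ ∃! S : 𝔖, IsMax S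
  ρ_nested : ∀ V W, V < W → (ρ V W).Nonempty ∧ DiamLE (ρ V W) ε
  ρdown_nonempty : ∀ W V, V < W → ∀ p, (ρdown W V p).Nonempty
  -- orthogonality
  orth_symm : ∀ V W, orth V W → orth W V
  orth_irrefl : ∀ V, ¬ orth V V
  orth_of_nest : ∀ V W U, V ≤ W → orth W U → orth V U
  orth_not_le : ∀ V W, orth V W → ¬ V ≤ W ∧ ¬ W ≤ V
  exists_container : ∀ T U, U ≤ T → (∃ V, V ≤ T ∧ orth V U) →
    ∃ W, W < T ∧ ∀ V, V ≤ T → orth V U → V ≤ W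
  -- transversality and consistency
  ρ_transverse : ∀ V W, ¬ orth V W → ¬ V ≤ W → ¬ W ≤ V →
    (ρ V W).Nonempty ∧ DiamLE (ρ V W) ε
  consistency_transverse : ∀ V W, ¬ orth V W → ¬ V ≤ W → ¬ W ≤ V → ∀ x,
    setDist (π W x) (ρ V W) ≤ ε ∨ setDist (π V x) (ρ W V) ≤ ε
  consistency_nested : ∀ V W, V < W → ∀ x,
    setDist (π W x) (ρ V W) ≤ ε ∨ DiamLE (π V x ∪ ⋃ p ∈ π W x, ρdown W V p) ε
  ρ_consistency : ∀ U V W, U ≤ V →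
    (V < W ∨ (¬ orth V W ∧ ¬ V ≤ W ∧ ¬ W ≤ V ∧ ¬ orth W U)) → setDist (ρ U W) (ρ V W) ≤ ε
  -- finite complexity
  finite_complexity : ∃ n : ℕ, ∀ s : Finset 𝔖, IsChain (· ≤ ·) (s : Set 𝔖) → s.card ≤ n
  -- large links
  large_links : ∀ W x x', ∃ Ts : Finset 𝔖,
    (Ts.card : ℝ) ≤ ε * setDist (π W x) (π W x') + ε ∧
    (∀ T ∈ Ts, T < W ∧ setDist (π W x) (ρ T W) ≤ ε * setDist (π W x) (π W x') + ε) ∧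
    ∀ T, T < W → (∃ T' ∈ Ts, T ≤ T') ∨ setDist (π T x) (π T x') < ε
  -- bounded geodesic image
  bounded_geodesic_image : ∀ V W, V < W → ∀ (a b : C W) (γ : ℝ → C W), IsGeodesic γ a b →
    DiamLE (⋃ t ∈ Icc 0 (dist a b), ρdown W V (γ t)) ε ∨
    ∃ t ∈ Icc 0 (dist a b), ∃ p ∈ ρ V W, dist (γ t) p ≤ ε
  -- partial realisation
  partial_realisation : ∀ (J : Set 𝔖), J.Pairwise orth → ∀ p : ∀ U, C U,
    (∀ U ∈ J, ∃ y, p U ∈ π U y) →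
    ∃ x, ∀ U ∈ J, setDist (π U x) {p U} ≤ ε ∧
      (∀ V, U < V → setDist (π V x) (ρ U V) ≤ ε) ∧
      (∀ W, ¬ orth W U → ¬ W ≤ U → ¬ U ≤ W → setDist (π W x) (ρ U W) ≤ ε)
  -- uniqueness
  uniqueness : ∀ κ : ℝ, 0 ≤ κ → ∃ θ : ℝ, ∀ x y, θ ≤ dist x y →
    ∃ V, κ ≤ setDist (π V x) (π V y)

/-! ### Hierarchically hyperbolic groups -/

theorem mulCayley_connected {Γ : Type u} [Group Γ] {S : Set Γ}
    (hS : Subgroup.closure S = ⊤) : (SimpleGraph.mulCayley S).Connected := by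
  have key : ∀ g : Γ, ∀ a : Γ, (SimpleGraph.mulCayley S).Reachable a (a * g) := by
    intro g
    have hg : g ∈ Subgroup.closure S := by rw [hS]; trivial
    induction hg using Subgroup.closure_induction with
    | mem x hx =>
      intro a
      by_cases h : a = a * x
      · rw [← h]
      · exact SimpleGraph.Adj.reachable
          ((SimpleGraph.mulCayley_adj' S a (a * x)).2 ⟨h, x, hx, Or.inl rfl⟩)
    | one => intro a; rw [mul_one]
    | mul x y _ _ hx hy =>
      intro a
      rw [← mul_assoc]
      exact (hx a).trans (hy (a * x))
    | inv x _ hx =>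
      intro a
      have := hx (a * x⁻¹)
      rw [inv_mul_cancel_right] at this
      exact this.symm
  refine (SimpleGraph.connected_iff _).2 ⟨fun a b => ?_, ⟨1⟩⟩
  simpa using key (a⁻¹ * b) a

/-- The metric on `Γ`, regarded as the vertex set of its Cayley graph with respect to `S`
(the word metric). -/
@[reducible]
noncomputable def cayleyMetric {Γ : Type u} [Group Γ] (S : Set Γ)
    (hS : Subgroup.closure S = ⊤) : MetricSpace Γ where
  dist a b := ((SimpleGraph.mulCayley S).dist a b : ℝ)
  dist_self a := by simp
  dist_comm a b := by rw [SimpleGraph.dist_comm]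
  dist_triangle a b c := by exact_mod_cast (mulCayley_connected hS).dist_triangle
  eq_of_dist_eq_zero {a b} h := by
    have h' : (SimpleGraph.mulCayley S).dist a b = 0 := by exact_mod_cast h
    exact (mulCayley_connected hS).dist_eq_zero_iff.1 h'

/-- The compatibility of a hierarchically hyperbolic structure `H` on (the Cayley graph of) `Γ`
with an action of `Γ` on the set of domains. The isometry `g : C U → C (g U)` is `T g h`
where `h : g • U = V`; naming the target `V` makes the cocycle rule `T_comp`, that is `g · h = gh`,
statable without transport along equalities of domains. -/
structure HHGAction {Γ : Type u} [Group Γ] [MetricSpace Γ] {𝔖 : Type} [PartialOrder 𝔖]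
    {C : 𝔖 → Type} [∀ U, MetricSpace (C U)] (H : HHS Γ 𝔖 C) [MulAction Γ 𝔖] where
  /-- finitely many orbits of domains -/
  cofinite : Finite (MulAction.orbitRel.Quotient Γ 𝔖)
  nest_iff : ∀ (g : Γ) (U V : 𝔖), g • U ≤ g • V ↔ U ≤ V
  orth_iff : ∀ (g : Γ) (U V : 𝔖), H.orth (g • U) (g • V) ↔ H.orth U V
  /-- the isometries between the hyperbolic spaces -/
  T : ∀ (g : Γ) {U V : 𝔖}, g • U = V → (C U ≃ᵢ C V)
  T_comp : ∀ (g h : Γ) {U V W : 𝔖} (h₁ : h • U = V) (h₂ : g • V = W) (h₃ : (g * h) • U = W)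
    (p : C U), T g h₂ (T h h₁ p) = T (g * h) h₃ p
  π_equivariant : ∀ (g x : Γ) (U : 𝔖),
    T g (rfl : g • U = g • U) '' H.π U x = H.π (g • U) (g * x)
  ρ_equivariant : ∀ (g : Γ) (U V : 𝔖), (V < U ∨ (¬ H.orth U V ∧ ¬ U ≤ V ∧ ¬ V ≤ U)) →
    T g (rfl : g • U = g • U) '' H.ρ V U = H.ρ (g • V) (g • U)

/-- `Γ` is a hierarchically hyperbolic group: for some finite generating set, its Cayley graph
carries a hierarchically hyperbolic structure on which `Γ` acts compatibly. -/
def IsHHG (Γ : Type u) [Group Γ] : Prop :=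
  ∃ (S : Set Γ) (hS : Subgroup.closure S = ⊤), S.Finite ∧
    letI : MetricSpace Γ := cayleyMetric S hS
    ∃ (𝔖 : Type) (_ : PartialOrder 𝔖) (C : 𝔖 → Type) (_ : ∀ U, MetricSpace (C U))
      (H : HHS Γ 𝔖 C) (_ : MulAction Γ 𝔖), Nonempty (HHGAction H)

end HierHyp

/-!
The group acts on each factor `X i` separately, so the product carries the standard hierarchically
hyperbolic structure of a product of hyperbolic spaces, and `Γ` inherits it through an orbit map.

* Each factor is hyperbolic (`IsCATNegOne.isHyperbolicSpace`). A comparison triangle is written down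
  in polar coordinates in the upper half plane, where the hyperbolic law of cosines
  (`cosh_dist_polarPoint`) shows that two sides issuing from a vertex stay at distance at most `2`
  up to the point where they touch the inscribed circle.
* `Γ` is finitely generated (`closure_eq_top_of_cobounded`), and its orbit map is Lipschitz, coarsely
  onto and metrically proper for the word metric.
* The domains are the nonempty sets of factors, nested by inclusion and orthogonal when disjoint. The
  space of the singleton `{i}` is `X i`, and all the others are points. A domain that is transverse to
  another one, or properly contains another one, has at least two elements, so every relative
  projection has a point as its target and most axioms hold trivially (`productHHS`). What remains
  is the hyperbolicity of the factors and the coarse properties of the orbit map, which give partial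
  realisation and uniqueness.
* Since no factor is permuted, `Γ` acts trivially on the domains and by the given isometries on
  their spaces.
-/

namespace HierHyp

/-! ### CAT(-1) spaces are hyperbolic -/

/-- The point of the upper half plane at distance `|s|` from `i`, in the direction making an angle
with the vertical half-line whose cosine and sine are `c` and `k`. -/
noncomputable def polarPoint (c k : ℝ) (h : c ^ 2 + k ^ 2 = 1) (s : ℝ) : UpperHalfPlane :=
  ⟨⟨k * Real.sinh s / (Real.cosh s - c * Real.sinh s), 1 / (Real.cosh s - c * Real.sinh s)⟩, by
    have hpos : 0 < Real.cosh s - c * Real.sinh s := by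
      nlinarith [Real.cosh_sq s, Real.cosh_pos s, sq_nonneg (k * Real.sinh s),
        mul_nonneg (sq_nonneg c) (sq_nonneg (Real.sinh s))]
    exact one_div_pos.2 hpos⟩

theorem cosh_sub_mul_sinh_pos {c k : ℝ} (h : c ^ 2 + k ^ 2 = 1) (s : ℝ) :
    0 < Real.cosh s - c * Real.sinh s := by
  have := (polarPoint c k h s).im_pos
  exact one_div_pos.1 this

/-- The hyperbolic law of cosines for two points in polar coordinates about `i`. -/
theorem cosh_dist_polarPoint {c k c' k' : ℝ} (h : c ^ 2 + k ^ 2 = 1) (h' : c' ^ 2 + k' ^ 2 = 1)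
    (s t : ℝ) :
    Real.cosh (dist (polarPoint c k h s) (polarPoint c' k' h' t)) =
      Real.cosh s * Real.cosh t - (c * c' + k * k') * (Real.sinh s * Real.sinh t) := by
  have hD := cosh_sub_mul_sinh_pos h s
  have hD' := cosh_sub_mul_sinh_pos h' t
  rw [UpperHalfPlane.cosh_dist']
  change ((k * Real.sinh s / (Real.cosh s - c * Real.sinh s) -
    k' * Real.sinh t / (Real.cosh t - c' * Real.sinh t)) ^ 2 +
    (1 / (Real.cosh s - c * Real.sinh s)) ^ 2 + (1 / (Real.cosh t - c' * Real.sinh t)) ^ 2) /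
    (2 * (1 / (Real.cosh s - c * Real.sinh s)) * (1 / (Real.cosh t - c' * Real.sinh t))) = _
  have e1 : k ^ 2 * Real.sinh s ^ 2 + 1 =
      (Real.cosh s - c * Real.sinh s) * (Real.cosh s + c * Real.sinh s) := by
    linear_combination Real.sinh s ^ 2 * h - Real.cosh_sq s
  have e2 : k' ^ 2 * Real.sinh t ^ 2 + 1 =
      (Real.cosh t - c' * Real.sinh t) * (Real.cosh t + c' * Real.sinh t) := by
    linear_combination Real.sinh t ^ 2 * h' - Real.cosh_sq t
  generalize Real.sinh s = S at *
  generalize Real.cosh s = C at *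
  generalize Real.sinh t = S' at *
  generalize Real.cosh t = C' at *
  have hE : C = (C - c * S) + c * S := by ring
  have hE' : C' = (C' - c' * S') + c' * S' := by ring
  set D := C - c * S
  set D' := C' - c' * S'
  rw [hE] at e1 ⊢
  rw [hE'] at e2 ⊢
  field_simp
  linear_combination D' ^ 2 * e1 + D ^ 2 * e2

theorem polarPoint_zero {c k c' k' : ℝ} (h : c ^ 2 + k ^ 2 = 1) (h' : c' ^ 2 + k' ^ 2 = 1) :
    polarPoint c k h 0 = polarPoint c' k' h' 0 := by
  apply UpperHalfPlane.ext
  simp [polarPoint]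

theorem dist_polarPoint {c k : ℝ} (h : c ^ 2 + k ^ 2 = 1) (s t : ℝ) :
    dist (polarPoint c k h s) (polarPoint c k h t) = |s - t| := by
  have e : Real.cosh (dist (polarPoint c k h s) (polarPoint c k h t)) = Real.cosh (s - t) := by
    rw [cosh_dist_polarPoint, Real.cosh_sub]
    linear_combination (-(Real.sinh s * Real.sinh t)) * h
  have := le_antisymm (Real.cosh_le_cosh.1 e.le) (Real.cosh_le_cosh.1 e.ge)
  rwa [abs_of_nonneg dist_nonneg] at this

theorem isGeodesic_polarPoint {c k : ℝ} (h : c ^ 2 + k ^ 2 = 1) {a : ℝ} (ha : 0 ≤ a) :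
    IsGeodesic (polarPoint c k h) (polarPoint c k h 0) (polarPoint c k h a) := by
  have hd : dist (polarPoint c k h 0) (polarPoint c k h a) = a := by
    rw [dist_polarPoint, zero_sub, abs_neg, abs_of_nonneg ha]
  exact ⟨rfl, by rw [hd], fun s _ t _ => dist_polarPoint h s t⟩

/-- For a triangle whose sides at a vertex are `u + v` and `u + w` and whose opposite side is `v + w`,
this is the quantity that determines the angle at the vertex in the law of cosines. -/
theorem cosh_add_sub_cosh_sub (v w : ℝ) :
    Real.cosh (v + w) - Real.cosh (v - w) = 2 * (Real.sinh v * Real.sinh w) := by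
  rw [Real.cosh_add, Real.cosh_sub]; ring

/-- Two sides of a geodesic triangle in a CAT(-1) space issuing from the same vertex stay at
distance at most `2` up to the Gromov product of the other two vertices. -/
theorem IsCATNegOne.dist_le_two {X : Type u} [MetricSpace X] (hX : IsCATNegOne X) {p q r : X}
    {α β : ℝ → X} (hα : IsGeodesic α p q) (hβ : IsGeodesic β p r) {t : ℝ} (ht0 : 0 ≤ t)
    (ht : 2 * t ≤ dist p q + dist p r - dist q r) : dist (α t) (β t) ≤ 2 := by
  obtain ⟨u, hu⟩ : ∃ u, u = (dist p q + dist p r - dist q r) / 2 := ⟨_, rfl⟩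
  obtain ⟨v, hv⟩ : ∃ v, v = (dist p q - dist p r + dist q r) / 2 := ⟨_, rfl⟩
  obtain ⟨w, hw⟩ : ∃ w, w = (dist p r - dist p q + dist q r) / 2 := ⟨_, rfl⟩
  have hv0 : 0 ≤ v := by linarith [dist_triangle p q r]
  have hw0 : 0 ≤ w := by linarith [dist_triangle p r q, dist_comm q r]
  have ha : dist p q = u + v := by linarith
  have hb : dist p r = u + w := by linarith
  have hc : dist q r = v + w := by linarith
  rcases ht0.eq_or_lt with rfl | htpos
  · rw [hα.1, hβ.1, dist_self]; norm_num
  have hupos : 0 < u := by linarith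
  have hsv : 0 ≤ Real.sinh v := Real.sinh_nonneg_iff.2 hv0
  have hsw : 0 ≤ Real.sinh w := Real.sinh_nonneg_iff.2 hw0
  have hsu : 0 < Real.sinh u := Real.sinh_pos_iff.2 hupos
  have key : ∀ x, 0 ≤ x → Real.sinh u * Real.sinh x ≤ Real.sinh (u + x) := fun x hx => by
    rw [Real.sinh_add]
    nlinarith [Real.sinh_lt_cosh x, Real.cosh_pos u, Real.sinh_nonneg_iff.2 hx]
  have hP : 0 < Real.sinh (u + v) := Real.sinh_pos_iff.2 (by linarith)
  have hQ : 0 < Real.sinh (u + w) := Real.sinh_pos_iff.2 (by linarith)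
  -- `1 - cos θ` for the comparison angle `θ`, by the hyperbolic law of cosines
  obtain ⟨m, hm⟩ : ∃ m, m = 2 * (Real.sinh v * Real.sinh w) /
    (Real.sinh (u + v) * Real.sinh (u + w)) := ⟨_, rfl⟩
  have hmPQ : m * (Real.sinh (u + v) * Real.sinh (u + w)) = 2 * (Real.sinh v * Real.sinh w) := by
    rw [hm]; field_simp
  have hm0 : 0 ≤ m := by rw [hm]; positivity
  have hmu : m * Real.sinh u ^ 2 ≤ 2 := by
    rw [hm, div_mul_eq_mul_div, div_le_iff₀ (by positivity)]
    have := mul_le_mul (key v hv0) (key w hw0) (by positivity) hP.le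
    nlinarith
  have hm2 : m ≤ 2 := by
    rw [hm, div_le_iff₀ (by positivity)]
    have h1 : Real.sinh v ≤ Real.sinh (u + v) := Real.sinh_le_sinh.2 (by linarith)
    have h2 : Real.sinh w ≤ Real.sinh (u + w) := Real.sinh_le_sinh.2 (by linarith)
    have := mul_le_mul h1 h2 hsw hP.le
    linarith
  have h1 : (1 : ℝ) ^ 2 + 0 ^ 2 = 1 := by norm_num
  have h2 : (1 - m) ^ 2 + Real.sqrt (m * (2 - m)) ^ 2 = 1 := by
    rw [Real.sq_sqrt (mul_nonneg hm0 (by linarith))]; ring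
  have cosh_eq : ∀ s t, Real.cosh (dist (polarPoint _ _ h1 s) (polarPoint _ _ h2 t)) =
      Real.cosh (s - t) + m * (Real.sinh s * Real.sinh t) := fun s t => by
    rw [cosh_dist_polarPoint, Real.cosh_sub]; ring
  have e0 : polarPoint _ _ h2 0 = polarPoint _ _ h1 0 := polarPoint_zero h2 h1
  have ea : dist (polarPoint _ _ h1 0) (polarPoint _ _ h1 (u + v)) = dist p q := by
    rw [dist_polarPoint, zero_sub, abs_neg, abs_of_nonneg (by linarith), ha]
  have eb : dist (polarPoint _ _ h1 0) (polarPoint _ _ h2 (u + w)) = dist p r := by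
    rw [← e0, dist_polarPoint, zero_sub, abs_neg, abs_of_nonneg (by linarith), hb]
  have ec : dist (polarPoint _ _ h1 (u + v)) (polarPoint _ _ h2 (u + w)) = dist q r := by
    have e : Real.cosh (dist (polarPoint _ _ h1 (u + v)) (polarPoint _ _ h2 (u + w))) =
        Real.cosh (v + w) := by
      rw [cosh_eq, hmPQ, ← cosh_add_sub_cosh_sub]
      ring_nf
    have := le_antisymm (Real.cosh_le_cosh.1 e.le) (Real.cosh_le_cosh.1 e.ge)
    rwa [abs_of_nonneg dist_nonneg, abs_of_nonneg (by linarith), ← hc] at this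
  have gβ := isGeodesic_polarPoint h2 (a := u + w) (by linarith)
  rw [e0] at gβ
  refine (hX.2 p q r _ _ _ ea ec eb α β _ _ hα hβ (isGeodesic_polarPoint h1 (by linarith)) gβ
    t ⟨ht0, by linarith⟩ t ⟨ht0, by linarith⟩).trans ?_
  have hst : Real.sinh t ^ 2 ≤ Real.sinh u ^ 2 :=
    pow_le_pow_left₀ (Real.sinh_nonneg_iff.2 ht0) (Real.sinh_le_sinh.2 (by linarith)) 2
  have h3 : Real.cosh (dist (polarPoint _ _ h1 t) (polarPoint _ _ h2 t)) ≤ Real.cosh 2 := by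
    rw [cosh_eq, sub_self, Real.cosh_zero]
    have : m * Real.sinh t ^ 2 ≤ 2 := (mul_le_mul_of_nonneg_left hst hm0).trans hmu
    have h4 : Real.cosh 2 = 1 + 2 * Real.sinh 1 ^ 2 := by
      rw [show (2 : ℝ) = 2 * 1 by norm_num, Real.cosh_two_mul, Real.cosh_sq]; ring
    have h5 : 1 ≤ Real.sinh 1 := Real.self_le_sinh_iff.2 zero_le_one
    nlinarith
  have := Real.cosh_le_cosh.1 h3
  rwa [abs_of_nonneg dist_nonneg, abs_of_pos (by norm_num)] at this

theorem IsGeodesic.reverse {X : Type u} [MetricSpace X] {γ : ℝ → X} {x y : X}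
    (h : IsGeodesic γ x y) : IsGeodesic (fun t => γ (dist x y - t)) y x := by
  refine ⟨by simp [h.2.1], by simp [dist_comm y x, h.1], fun s hs t ht => ?_⟩
  rw [dist_comm y x] at hs ht
  rw [h.2.2 _ ⟨by linarith [hs.2], by linarith [hs.1]⟩ _ ⟨by linarith [ht.2], by linarith [ht.1]⟩,
    abs_sub_comm]
  congr 1
  ring

theorem IsCATNegOne.isHyperbolicSpace {X : Type u} [MetricSpace X] (hX : IsCATNegOne X) :
    IsHyperbolicSpace X 2 := by
  refine ⟨hX.1, fun x y z α β γ hα hβ hγ t ht => ?_⟩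
  rcases le_total (2 * t) (dist x y + dist x z - dist y z) with h | h
  · right
    exact ⟨t, ⟨ht.1, by linarith [ht.2, dist_triangle x y z, dist_triangle x z y, dist_comm y z]⟩,
      hX.dist_le_two hα hγ ht.1 h⟩
  · left
    refine ⟨dist x y - t, ⟨by linarith [ht.2], by
      linarith [dist_triangle x z y, dist_comm z y]⟩, ?_⟩
    have := hX.dist_le_two hα.reverse hβ (t := dist x y - t) (by linarith [ht.2])
      (by linarith [dist_comm x y])
    simpa using this

theorem IsGeodesic.map {X : Type u} {Y : Type v} [MetricSpace X] [MetricSpace Y] (e : X ≃ᵢ Y)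
    {γ : ℝ → X} {x y : X} (h : IsGeodesic γ x y) : IsGeodesic (fun t => e (γ t)) (e x) (e y) := by
  refine ⟨congrArg e h.1, by rw [e.dist_eq]; exact congrArg e h.2.1, fun s hs t ht => ?_⟩
  rw [e.dist_eq] at hs ht ⊢
  exact h.2.2 s hs t ht

theorem IsHyperbolicSpace.of_isometryEquiv {X : Type u} {Y : Type v} [MetricSpace X]
    [MetricSpace Y] {δ : ℝ} (h : IsHyperbolicSpace X δ) (e : X ≃ᵢ Y) : IsHyperbolicSpace Y δ := by
  refine ⟨fun x y => ?_, fun x y z α β γ hα hβ hγ t ht => ?_⟩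
  · obtain ⟨γ, hγ⟩ := h.1 (e.symm x) (e.symm y)
    exact ⟨_, by simpa using hγ.map e⟩
  · simpa [e.symm.dist_eq] using h.2 _ _ _ _ _ _ (hα.map e.symm) (hβ.map e.symm) (hγ.map e.symm) t
      (by rwa [e.symm.dist_eq])

theorem IsHyperbolicSpace.mono {X : Type u} [MetricSpace X] {δ ε : ℝ} (h : IsHyperbolicSpace X δ)
    (hδ : δ ≤ ε) : IsHyperbolicSpace X ε := by
  refine ⟨h.1, fun x y z α β γ hα hβ hγ t ht => ?_⟩
  exact (h.2 x y z α β γ hα hβ hγ t ht).imp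
    (fun ⟨s, hs, hs'⟩ => ⟨s, hs, hs'.trans hδ⟩) (fun ⟨s, hs, hs'⟩ => ⟨s, hs, hs'.trans hδ⟩)

theorem isHyperbolicSpace_of_subsingleton {X : Type u} [MetricSpace X] [Subsingleton X] {δ : ℝ}
    (hδ : 0 ≤ δ) : IsHyperbolicSpace X δ := by
  refine ⟨fun x y => ⟨fun _ => x, rfl, Subsingleton.elim _ _, fun s hs t ht => ?_⟩,
    fun x y z α β γ _ _ _ t ht => Or.inl ⟨0, ⟨le_rfl, dist_nonneg⟩, ?_⟩⟩
  · rw [Subsingleton.elim x y, dist_self, Icc_self] at hs ht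
    rw [hs, ht]; simp
  · rw [Subsingleton.elim (α t) (β 0), dist_self]; exact hδ

/-! ### Word metrics and orbit maps -/

theorem IsGeodesicSpace.preconnectedSpace {X : Type u} [MetricSpace X] (hX : IsGeodesicSpace X) :
    PreconnectedSpace X := by
  refine ⟨isPreconnected_of_forall_pair fun x _ y _ => ?_⟩
  obtain ⟨γ, h0, h1, hγ⟩ := hX x y
  refine ⟨γ '' Icc 0 (dist x y), subset_univ _, ⟨0, ⟨le_rfl, dist_nonneg⟩, h0⟩,
    ⟨dist x y, ⟨dist_nonneg, le_rfl⟩, h1⟩, isPreconnected_Icc.image _ ?_⟩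
  have : LipschitzOnWith 1 γ (Icc 0 (dist x y)) :=
    LipschitzOnWith.of_dist_le_mul fun s hs t ht => by
      rw [hγ s hs t ht, Real.dist_eq, NNReal.coe_one, one_mul]
  exact this.continuousOn

/-- An orbit map is written as a map `o` from the group with `dist (o (g * h)) (o (g * k)) =
dist (o h) (o k)`. If the translates of a ball of radius `R` cover a connected space, the elements
moving its centre by less than `2 * R` generate: the neighbourhoods of the orbit of the
subgroup they generate and of its complement are open, disjoint and cover the space. -/
theorem closure_eq_top_of_cobounded {Γ : Type u} [Group Γ] {P : Type v} [PseudoMetricSpace P]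
    [PreconnectedSpace P] (o : Γ → P) (ho : ∀ g h k, dist (o (g * h)) (o (g * k)) = dist (o h) (o k))
    {R : ℝ} (hR : ∀ z, ∃ g, dist (o g) z < R) :
    Subgroup.closure {g | dist (o 1) (o g) < 2 * R} = ⊤ := by
  set H := Subgroup.closure {g | dist (o 1) (o g) < 2 * R}
  rw [Subgroup.eq_top_iff']
  by_contra! hne
  obtain ⟨g₀, hg₀⟩ := hne
  obtain ⟨g₁, hg₁⟩ := hR (o 1)
  have hRpos : 0 < R := dist_nonneg.trans_lt hg₁
  have hU : ∀ A : Set Γ, IsOpen (⋃ g ∈ A, Metric.ball (o g) R) := fun A =>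
    isOpen_biUnion fun _ _ => Metric.isOpen_ball
  have hmem : ∀ (A : Set Γ) g, g ∈ A → o g ∈ ⋃ g ∈ A, Metric.ball (o g) R := fun A g hg =>
    mem_biUnion hg (Metric.mem_ball_self hRpos)
  obtain ⟨z, -, hz, hz'⟩ := isPreconnected_univ (α := P) _ _ (hU H) (hU (H : Set Γ)ᶜ)
    (fun z _ => by
      obtain ⟨g, hg⟩ := hR z
      have hg' : z ∈ Metric.ball (o g) R := by rwa [Metric.mem_ball, dist_comm]
      by_cases hgH : g ∈ (H : Set Γ)
      · exact Or.inl (mem_biUnion hgH hg')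
      · exact Or.inr (mem_biUnion hgH hg'))
    ⟨o 1, trivial, hmem _ _ H.one_mem⟩ ⟨o g₀, trivial, hmem _ _ hg₀⟩
  obtain ⟨h, hh, hzh⟩ := mem_iUnion₂.1 hz
  obtain ⟨k, hk, hzk⟩ := mem_iUnion₂.1 hz'
  have hlt : dist (o h) (o k) < 2 * R := by
    linarith [dist_triangle_left (o h) (o k) z, Metric.mem_ball.1 hzh, Metric.mem_ball.1 hzk]
  have hhk : h⁻¹ * k ∈ H := Subgroup.subset_closure (by
    rw [mem_ofPred_eq, ← ho h, mul_one, mul_inv_cancel_left]; exact hlt)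
  exact hk (by simpa using H.mul_mem hh hhk)

/-- Orbit maps are Lipschitz for the word metric. -/
theorem dist_le_mul_mulCayley_dist {Γ : Type u} [Group Γ] {P : Type v} [PseudoMetricSpace P]
    (o : Γ → P) (ho : ∀ g h k, dist (o (g * h)) (o (g * k)) = dist (o h) (o k))
    {S : Set Γ} (hS : Subgroup.closure S = ⊤) {M : ℝ} (hM : ∀ g ∈ S, dist (o 1) (o g) ≤ M)
    (x x' : Γ) : dist (o x) (o x') ≤ M * (SimpleGraph.mulCayley S).dist x x' := by
  obtain ⟨p, hp⟩ := (mulCayley_connected hS).exists_walk_length_eq_dist x x'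
  rw [← hp]
  clear hp
  induction p with
  | nil => simp
  | @cons x w x' h p ih =>
    have hxw : dist (o x) (o w) ≤ M := by
      obtain ⟨-, h | h⟩ := (SimpleGraph.mulCayley_adj S x w).1 h
      · have := hM _ h
        rwa [← ho x, mul_one, mul_inv_cancel_left] at this
      · have := hM _ h
        rwa [← ho w, mul_one, mul_inv_cancel_left, dist_comm] at this
    rw [SimpleGraph.Walk.length_cons]
    push_cast
    linarith [dist_triangle (o x) (o w) (o x')]

theorem mulCayley_dist_mul_left_le {Γ : Type u} [Group Γ] {S : Set Γ}
    (hS : Subgroup.closure S = ⊤) (g x y : Γ) :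
    (SimpleGraph.mulCayley S).dist (g * x) (g * y) ≤ (SimpleGraph.mulCayley S).dist x y := by
  obtain ⟨p, hp⟩ := (mulCayley_connected hS).exists_walk_length_eq_dist x y
  let f : SimpleGraph.mulCayley S →g SimpleGraph.mulCayley S :=
    ⟨(g * ·), fun h => SimpleGraph.mulCayley_adj_mul_iff_right.2 h⟩
  have := SimpleGraph.dist_le (p.map f)
  rwa [SimpleGraph.Walk.length_map, hp] at this

/-- Elements that are far apart in the word metric have far apart images under a proper orbit
map. -/
theorem exists_forall_le_mulCayley_dist {Γ : Type u} [Group Γ] {P : Type v} [PseudoMetricSpace P]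
    (o : Γ → P) (ho : ∀ g h k, dist (o (g * h)) (o (g * k)) = dist (o h) (o k))
    (hfin : ∀ r, {g | dist (o 1) (o g) ≤ r}.Finite)
    {S : Set Γ} (hS : Subgroup.closure S = ⊤) (κ : ℝ) :
    ∃ θ : ℝ, ∀ x x', θ ≤ (SimpleGraph.mulCayley S).dist x x' → κ < dist (o x) (o x') := by
  obtain ⟨N, hN⟩ := ((hfin κ).image fun g => (SimpleGraph.mulCayley S).dist 1 g).bddAbove
  refine ⟨N + 1, fun x x' hθ => ?_⟩
  by_contra! hle
  have hmem : x⁻¹ * x' ∈ {g | dist (o 1) (o g) ≤ κ} := by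
    rwa [mem_ofPred_eq, ← ho x, mul_one, mul_inv_cancel_left]
  have h1 := hN (mem_image_of_mem _ hmem)
  have h2 := mulCayley_dist_mul_left_le hS x 1 (x⁻¹ * x')
  rw [mul_one, mul_inv_cancel_left] at h2
  have h3 : ((SimpleGraph.mulCayley S).dist x x' : ℝ) ≤ N := by exact_mod_cast h2.trans h1
  linarith

theorem dist_getVert_of_length_eq_dist {V : Type u} {G : SimpleGraph V} (hG : G.Connected) {x y : V}
    (p : G.Walk x y) (hp : p.length = G.dist x y) {i j : ℕ} (hij : i ≤ j) (hj : j ≤ p.length) :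
    G.dist (p.getVert i) (p.getVert j) = j - i := by
  have key : ∀ i j, i ≤ j → G.dist (p.getVert i) (p.getVert j) ≤ j - i := fun i j hij => by
    have := SimpleGraph.dist_le ((p.drop i).take (j - i))
    rw [SimpleGraph.Walk.take_length, SimpleGraph.Walk.drop_getVert,
      Nat.add_sub_cancel' hij] at this
    exact this.trans (min_le_left _ _)
  have h1 := key 0 i (Nat.zero_le _)
  have h2 := key j _ hj
  have h3 := key i j hij
  rw [SimpleGraph.Walk.getVert_zero] at h1
  rw [SimpleGraph.Walk.getVert_length] at h2
  have h4 : G.dist x y ≤ G.dist x (p.getVert i) + G.dist (p.getVert i) y := hG.dist_triangle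
  have h5 : G.dist (p.getVert i) y ≤
    G.dist (p.getVert i) (p.getVert j) + G.dist (p.getVert j) y := hG.dist_triangle
  omega

theorem isQuasigeodesicSpace_cayleyMetric {Γ : Type u} [Group Γ] (S : Set Γ)
    (hS : Subgroup.closure S = ⊤) : @IsQuasigeodesicSpace Γ (cayleyMetric S hS) := by
  let := cayleyMetric S hS
  refine ⟨1, le_rfl, fun x y => ?_⟩
  obtain ⟨p, hp⟩ := (mulCayley_connected hS).exists_walk_length_eq_dist x y
  refine ⟨p.length, fun t => p.getVert ⌊t⌋₊, Nat.cast_nonneg _, by simp, by simp, ?_⟩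
  have key : ∀ s t : ℝ, 0 ≤ s → s ≤ t → t ≤ p.length →
      |s - t| / 1 - 1 ≤ dist (p.getVert ⌊s⌋₊) (p.getVert ⌊t⌋₊) ∧
      dist (p.getVert ⌊s⌋₊) (p.getVert ⌊t⌋₊) ≤ 1 * |s - t| + 1 := by
    intro s t hs hst ht
    have hfl : ⌊s⌋₊ ≤ ⌊t⌋₊ := Nat.floor_mono hst
    have hd : dist (p.getVert ⌊s⌋₊) (p.getVert ⌊t⌋₊) = (⌊t⌋₊ : ℝ) - ⌊s⌋₊ := by
      change ((SimpleGraph.mulCayley S).dist _ _ : ℝ) = _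
      rw [dist_getVert_of_length_eq_dist (mulCayley_connected hS) p hp hfl
        (Nat.floor_le_of_le ht), Nat.cast_sub hfl]
    rw [hd, abs_of_nonpos (by linarith)]
    have h1 := Nat.floor_le hs
    have h2 := Nat.floor_le (hs.trans hst)
    have h3 := Nat.lt_floor_add_one s
    have h4 := Nat.lt_floor_add_one t
    constructor <;> linarith
  intro s hs t ht
  rcases le_total s t with h | h
  · exact key s t hs.1 h ht.2
  · rw [abs_sub_comm, dist_comm]
    exact key t s ht.1 h hs.2

/-! ### The standard structure on a product of hyperbolic spaces -/

/-- The domains of the standard structure on a product of `n` hyperbolic spaces: the nonempty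
sets of factors. -/
def FactorSet (n : ℕ) : Type := {A : Finset (Fin n) // A.Nonempty}

instance (n : ℕ) : PartialOrder (FactorSet n) :=
  inferInstanceAs (PartialOrder {A : Finset (Fin n) // A.Nonempty})

instance (n : ℕ) : Fintype (FactorSet n) :=
  inferInstanceAs (Fintype {A : Finset (Fin n) // A.Nonempty})

/-- The space attached to a set `U` of factors, the product of the `Y i` over all `i` with
`U = {i}`: it is `Y i` if `U` is the singleton `{i}`, and a point otherwise. -/
abbrev FactorSpace {n : ℕ} (Y : Fin n → Type) (U : FactorSet n) : Type :=
  ∀ i : {i // U.1 = {i}}, Y i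

theorem FactorSpace.subsingleton {n : ℕ} (Y : Fin n → Type) {V W : FactorSet n}
    (hd : ¬ Disjoint V.1 W.1) (hle : ¬ W ≤ V) : Subsingleton (FactorSpace Y W) := by
  have : IsEmpty {i // W.1 = {i}} := by
    refine ⟨fun ⟨i, hi⟩ => hle ?_⟩
    change W.1 ⊆ V.1
    rw [hi, Finset.disjoint_singleton_right, not_not] at hd
    rwa [hi, Finset.singleton_subset_iff]
  infer_instance

theorem FactorSpace.subsingleton_of_lt {n : ℕ} (Y : Fin n → Type) {V W : FactorSet n} (h : V < W) :
    Subsingleton (FactorSpace Y W) := by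
  refine FactorSpace.subsingleton Y (fun hd => ?_) (not_le_of_gt h)
  exact V.2.ne_empty ((Finset.disjoint_self_iff_empty _).1
    (hd.mono_right (show V.1 ⊆ W.1 from h.le)))

theorem FactorSpace.isHyperbolicSpace {n : ℕ} (Y : Fin n → Type) [∀ i, MetricSpace (Y i)] {δ : ℝ}
    (hδ : 0 ≤ δ) (hY : ∀ i, IsHyperbolicSpace (Y i) δ) (U : FactorSet n) :
    IsHyperbolicSpace (FactorSpace Y U) δ := by
  by_cases hU : ∃ i, U.1 = {i}
  · obtain ⟨i, hi⟩ := hU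
    let : Unique {i // U.1 = {i}} :=
      ⟨⟨⟨i, hi⟩⟩, fun ⟨j, hj⟩ => Subtype.ext (Finset.singleton_injective (hj.symm.trans hi))⟩
    let e : FactorSpace Y U ≃ᵢ Y i :=
      ⟨Equiv.piUnique fun j : {i // U.1 = {i}} => Y j, fun p q => by
        rw [edist_pi_def, Finset.univ_unique, Finset.sup_singleton]; rfl⟩
    exact (hY i).of_isometryEquiv e.symm
  · have : IsEmpty {i // U.1 = {i}} := ⟨fun ⟨i, hi⟩ => hU ⟨i, hi⟩⟩
    exact isHyperbolicSpace_of_subsingleton hδ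

theorem setDist_le {X : Type u} [MetricSpace X] {A B : Set X} {a b : X} (ha : a ∈ A) (hb : b ∈ B) :
    setDist A B ≤ dist a b :=
  csInf_le ⟨0, by rintro _ ⟨x, -, y, -, rfl⟩; exact dist_nonneg⟩ (mem_image2_of_mem ha hb)

theorem setDist_nonneg {X : Type u} [MetricSpace X] (A B : Set X) : 0 ≤ setDist A B :=
  Real.sInf_nonneg (by rintro _ ⟨x, -, y, -, rfl⟩; exact dist_nonneg)

theorem setDist_singleton {X : Type u} [MetricSpace X] (a b : X) : setDist {a} {b} = dist a b := by
  rw [setDist, image2_singleton, csInf_singleton]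

theorem setDist_univ_le_of_subsingleton {X : Type u} [MetricSpace X] [Subsingleton X] {δ : ℝ}
    (hδ : 0 ≤ δ) (a : X) : setDist {a} univ ≤ δ :=
  (setDist_le (mem_singleton a) (mem_univ a)).trans (by rwa [dist_self])

theorem DiamLE.of_subsingleton {X : Type u} [MetricSpace X] [Subsingleton X] {δ : ℝ}
    (hδ : 0 ≤ δ) (A : Set X) : DiamLE A δ := fun a _ b _ => by
  rwa [Subsingleton.elim a b, dist_self]

/-- A quasigeodesic space with coarsely Lipschitz maps `f i` to hyperbolic spaces that are jointly
coarsely onto and metrically proper is hierarchically hyperbolic: nesting is inclusion and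
orthogonality is disjointness of sets of factors. Every space that is the target of a relative
projection is a point, so the relative projections can only be `univ`. -/
def productHHS {G : Type u} [MetricSpace G] {n : ℕ} (Y : Fin n → Type) [∀ i, MetricSpace (Y i)]
    [∀ i, Nonempty (Y i)]
    (f : ∀ i, G → Y i) {ε : ℝ} (hε : 1 ≤ ε) (hcard : Fintype.card (FactorSet n) ≤ ε)
    (hG : IsQuasigeodesicSpace G) (hY : ∀ i, IsHyperbolicSpace (Y i) ε)
    (hlip : ∀ x x' i, dist (f i x) (f i x') ≤ ε * dist x x' + ε)
    (hcob : ∀ z : ∀ i, Y i, ∃ x, ∀ i, dist (f i x) (z i) ≤ ε)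
    (huniq : ∀ κ : ℝ, 0 ≤ κ → ∃ θ : ℝ, ∀ x x', θ ≤ dist x x' → ∃ i, κ ≤ dist (f i x) (f i x')) :
    HHS G (FactorSet n) (FactorSpace Y) :=
  have hε0 : 0 ≤ ε := zero_le_one.trans hε
  have hcob' : ∀ z : ∀ U, FactorSpace Y U,
      ∃ x, ∀ U, dist (fun i : {i // U.1 = {i}} => f i x) (z U) ≤ ε := fun z => by
    obtain ⟨x, hx⟩ := hcob fun i => z ⟨{i}, Finset.singleton_nonempty i⟩ ⟨i, rfl⟩
    refine ⟨x, fun ⟨A, hA⟩ => (dist_pi_le_iff hε0).2 ?_⟩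
    rintro ⟨i, hi⟩
    change A = {i} at hi
    subst hi
    exact hx i
  { ε := ε
    orth := fun U V => Disjoint U.1 V.1
    π := fun U x => {fun i : {i // U.1 = {i}} => f i x}
    ρ := fun _ _ => univ
    ρdown := fun _ _ _ => univ
    one_le_ε := hε
    quasigeodesic := hG
    hyperbolic := FactorSpace.isHyperbolicSpace Y hε0 hY
    π_nonempty := fun _ _ => singleton_nonempty _
    π_diam := by
      rintro U x _ rfl _ rfl
      rwa [dist_self]
    π_lipschitz := fun U x x' => by
      rw [setDist_singleton]
      exact (dist_pi_le_iff (by positivity)).2 fun i => hlip x x' i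
    π_coarsely_onto := fun U p => by
      classical
      obtain ⟨x, hx⟩ := hcob' fun V => if h : U = V then h ▸ p else fun i => Classical.arbitrary _
      refine ⟨x, _, rfl, ?_⟩
      simpa [dist_comm] using hx U
    exists_max := by
      rcases isEmpty_or_nonempty (FactorSet n) with h | ⟨⟨A, hA⟩⟩
      · exact Or.inl h
      · right
        have htop : ∀ V : FactorSet n, V ≤ ⟨Finset.univ, hA.mono (Finset.subset_univ A)⟩ :=
          fun V => Finset.subset_univ V.1
        exact ⟨_, fun V _ => htop V, fun V hV => le_antisymm (htop V) (hV (htop V))⟩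
    ρ_nested := fun V W h =>
      have := FactorSpace.subsingleton_of_lt Y h
      ⟨univ_nonempty, .of_subsingleton hε0 _⟩
    ρdown_nonempty := fun _ _ _ _ => univ_nonempty
    orth_symm := fun _ _ h => h.symm
    orth_irrefl := fun V h => V.2.ne_empty ((Finset.disjoint_self_iff_empty _).1 h)
    orth_of_nest := fun V W U h h' => h'.mono_left (show V.1 ⊆ W.1 from h)
    orth_not_le := fun V W h =>
      ⟨fun hle => V.2.ne_empty ((Finset.disjoint_self_iff_empty _).1
        (h.mono_right (show V.1 ⊆ W.1 from hle))),
      fun hle => W.2.ne_empty ((Finset.disjoint_self_iff_empty _).1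
        (h.mono_left (show W.1 ⊆ V.1 from hle)))⟩
    exists_container := by
      rintro T U hUT ⟨V, hVT, hVU⟩
      have hsub : ∀ V : FactorSet n, V ≤ T → Disjoint V.1 U.1 → V.1 ⊆ T.1 \ U.1 :=
        fun V h h' => Finset.subset_sdiff.2 ⟨h, h'⟩
      refine ⟨⟨T.1 \ U.1, V.2.mono (hsub V hVT hVU)⟩, ?_, hsub⟩
      exact Finset.sdiff_ssubset (show U.1 ⊆ T.1 from hUT) U.2
    ρ_transverse := fun V W h _ h' =>
      have := FactorSpace.subsingleton Y h h'
      ⟨univ_nonempty, .of_subsingleton hε0 _⟩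
    consistency_transverse := fun V W h _ h' x =>
      have := FactorSpace.subsingleton Y h h'
      Or.inl (setDist_univ_le_of_subsingleton hε0 _)
    consistency_nested := fun V W h x =>
      have := FactorSpace.subsingleton_of_lt Y h
      Or.inl (setDist_univ_le_of_subsingleton hε0 _)
    ρ_consistency := fun U V W _ _ =>
      (setDist_le (mem_univ (Classical.arbitrary _)) (mem_univ (Classical.arbitrary _))).trans
        (by rwa [dist_self])
    finite_complexity := ⟨Fintype.card (FactorSet n), fun s _ => s.card_le_univ⟩
    large_links := fun W x x' => by
      classical
      have h0 : 0 ≤ ε * setDist {fun i : {i // W.1 = {i}} => f i x}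
        {fun i : {i // W.1 = {i}} => f i x'} := mul_nonneg hε0 (setDist_nonneg _ _)
      refine ⟨Finset.univ.filter (· < W), ?_, fun T hT => ?_,
        fun T hT => Or.inl ⟨T, by simpa using hT, le_rfl⟩⟩
      · have : ((Finset.univ.filter (· < W)).card : ℝ) ≤ Fintype.card (FactorSet n) :=
          Nat.cast_le.2 (Finset.card_le_univ _)
        linarith
      · have hT' := (Finset.mem_filter.1 hT).2
        have := FactorSpace.subsingleton_of_lt Y hT'
        exact ⟨hT', setDist_univ_le_of_subsingleton (by linarith) _⟩
    bounded_geodesic_image := fun V W h a b γ _ => by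
      right
      exact ⟨0, ⟨le_rfl, dist_nonneg⟩, γ 0, mem_univ _, by rwa [dist_self]⟩
    partial_realisation := fun J _ p _ => by
      obtain ⟨x, hx⟩ := hcob' p
      refine ⟨x, fun U _ => ⟨by rw [setDist_singleton]; exact hx U, fun V hV => ?_,
        fun W h h' h'' => ?_⟩⟩
      · have := FactorSpace.subsingleton_of_lt Y hV
        exact setDist_univ_le_of_subsingleton hε0 _
      · have := FactorSpace.subsingleton Y (fun hd => h hd.symm) h'
        exact setDist_univ_le_of_subsingleton hε0 _
    uniqueness := fun κ hκ => by
      obtain ⟨θ, hθ⟩ := huniq κ hκ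
      refine ⟨θ, fun x x' h => ?_⟩
      obtain ⟨i, hi⟩ := hθ x x' h
      refine ⟨⟨{i}, Finset.singleton_nonempty i⟩, ?_⟩
      rw [setDist_singleton]
      exact hi.trans (dist_le_pi_dist (fun j : {j // ({i} : Finset (Fin n)) = {j}} => f j x)
        (fun j => f j x') ⟨i, rfl⟩) }

/-- The isometry between the spaces attached to equal sets of factors that is induced by isometries
of the factors. -/
def factorSpaceIsometryEquiv {n : ℕ} {Y : Fin n → Type} [∀ i, MetricSpace (Y i)]
    (φ : ∀ i, Y i ≃ᵢ Y i) {U V : FactorSet n} (h : U = V) : FactorSpace Y U ≃ᵢ FactorSpace Y V where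
  toFun p i := φ i (p ⟨i, h ▸ i.2⟩)
  invFun p i := (φ i).symm (p ⟨i, h ▸ i.2⟩)
  left_inv p := by ext; simp
  right_inv p := by ext; simp
  isometry_toFun := by
    subst h
    intro p q
    simp only [edist_pi_def, (φ _).isometry.edist_eq]

/-- A group acting properly and coboundedly by isometries on a product of hyperbolic spaces (with
the supremum metric), preserving the factors, is hierarchically hyperbolic. It acts trivially on the
domains. -/
theorem isHHG_of_isHyperbolicSpace_factors {Γ : Type u} [Group Γ] {n : ℕ} (Y : Fin n → Type)
    [∀ i, MetricSpace (Y i)] (a : ∀ i, Γ →* (Y i ≃ᵢ Y i)) (y : ∀ i, Y i) {δ R : ℝ}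
    (hY : ∀ i, IsHyperbolicSpace (Y i) δ)
    (hprop : ∀ r, {g | dist y (fun i => a i g (y i)) ≤ r}.Finite)
    (hcob : ∀ z : ∀ i, Y i, ∃ g, dist (fun i => a i g (y i)) z ≤ R) : IsHHG Γ := by
  have : ∀ i, Nonempty (Y i) := fun i => ⟨y i⟩
  have : ∀ i, PreconnectedSpace (Y i) := fun i => (hY i).1.preconnectedSpace
  obtain ⟨o, ho⟩ : ∃ o : Γ → ∀ i, Y i, o = fun g i => a i g (y i) := ⟨_, rfl⟩
  have hog : ∀ g i, o g i = a i g (y i) := fun g i => by rw [ho]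
  have ho1 : o 1 = y := by ext i; simp [hog]
  have hinv : ∀ g h k, dist (o (g * h)) (o (g * k)) = dist (o h) (o k) := fun g h k => by
    simp only [dist_pi_def, nndist, hog, map_mul, IsometryEquiv.mul_apply, IsometryEquiv.dist_eq]
  have hprop' : ∀ r, {g | dist (o 1) (o g) ≤ r}.Finite := by
    rw [ho1, ho]; exact hprop
  obtain ⟨S, hSdef⟩ : ∃ S, S = {g | dist (o 1) (o g) < 2 * (R + 1)} := ⟨_, rfl⟩
  have hS : Subgroup.closure S = ⊤ := by
    rw [hSdef]
    refine closure_eq_top_of_cobounded o hinv fun z => ?_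
    obtain ⟨g, hg⟩ := hcob z
    exact ⟨g, by rw [ho]; linarith⟩
  have hSM : ∀ g ∈ S, dist (o 1) (o g) ≤ 2 * (R + 1) := fun g hg => by
    rw [hSdef] at hg; exact le_of_lt hg
  refine ⟨S, hS, (hprop' (2 * (R + 1))).subset hSM, ?_⟩
  let : MetricSpace Γ := cayleyMetric S hS
  obtain ⟨ε, hε1, hεδ, hεR, hεM, hεc⟩ : ∃ ε : ℝ, 1 ≤ ε ∧ δ ≤ ε ∧ R ≤ ε ∧ 2 * (R + 1) ≤ ε ∧
      (Fintype.card (FactorSet n) : ℝ) ≤ ε :=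
    ⟨max 1 (max δ (max R (max (2 * (R + 1)) (Fintype.card (FactorSet n))))), by simp⟩
  have hε0 : 0 ≤ ε := zero_le_one.trans hε1
  let H : HHS Γ (FactorSet n) (FactorSpace Y) := productHHS Y (fun i g => o g i) hε1 hεc
    (isQuasigeodesicSpace_cayleyMetric S hS) (fun i => (hY i).mono hεδ)
    (fun x x' i => by
      have h1 := dist_le_mul_mulCayley_dist o hinv hS hSM x x'
      have h2 := dist_le_pi_dist (o x) (o x') i
      have h3 := mul_le_mul_of_nonneg_right hεM (dist_nonneg (x := x) (y := x'))
      change dist (o x) (o x') ≤ _ * dist x x' at h1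
      linarith)
    (fun z => by
      obtain ⟨g, hg⟩ := hcob z
      exact ⟨g, fun i => by
        rw [hog]; exact ((dist_le_pi_dist (fun i => a i g (y i)) z i).trans hg).trans hεR⟩)
    (fun κ hκ => by
      obtain ⟨θ, hθ⟩ := exists_forall_le_mulCayley_dist o hinv hprop' hS κ
      refine ⟨θ, fun x x' h => ?_⟩
      by_contra! hlt
      exact (hθ x x' h).not_ge ((dist_pi_le_iff hκ).2 fun i => (hlt i).le))
  let act : MulAction Γ (FactorSet n) :=
    { smul := fun _ U => U
      one_smul := fun _ => rfl
      mul_smul := fun _ _ _ => rfl }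
  refine ⟨FactorSet n, inferInstance, FactorSpace Y, inferInstance, H, act, ⟨?_⟩⟩
  exact
    { cofinite := Quotient.finite _
      nest_iff := fun _ _ _ => Iff.rfl
      orth_iff := fun _ _ _ => Iff.rfl
      T := fun g {U V} h => factorSpaceIsometryEquiv (fun i => a i g) (U := U) (V := V) h
      T_comp := fun g h U V W h₁ h₂ h₃ p => by
        ext i
        change a i g (a i h _) = a i (g * h) _
        rw [map_mul]
        rfl
      π_equivariant := fun g x U => by
        refine (image_singleton).trans (congrArg singleton ?_)
        ext i
        change a i g (o x i) = o (g * x) i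
        rw [hog, hog, map_mul]
        rfl
      ρ_equivariant := fun g U V _ => image_univ_of_surjective (IsometryEquiv.surjective _) }

end HierHyp

open HierHyp in
theorem mainTheorem2 {Γ : Type u} [Group Γ] {n : ℕ} (X : Fin n → Type v)
    [∀ i, MetricSpace (X i)] [∀ i, Nonempty (X i)] [∀ i, ProperSpace (X i)]
    (hcat : ∀ i, HierHyp.IsCATNegOne (X i))
    (hirr : ∀ i, HierHyp.IsIrreducibleSpace (X i))
    (hmin : ∀ i, HierHyp.IsMinimalSpace (X i))
    [MulAction Γ (PiLp 2 X)]
    -- the action is by isometries, proper and cocompact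
    [IsIsometricSMul Γ (PiLp 2 X)]
    [ProperlyDiscontinuousSMul Γ (PiLp 2 X)]
    (hcocompact : ∃ K : Set (PiLp 2 X), IsCompact K ∧ ∀ x, ∃ g : Γ, ∃ k ∈ K, g • k = x)
    -- every element acts as a product of isometries of the factors
    (hfactors : ∀ g : Γ, ∃ φ : ∀ i, X i ≃ᵢ X i, ∀ (x : PiLp 2 X) (i : Fin n),
      (g • x) i = φ i (x i)) :
    HierHyp.IsHHG Γ := by
  choose φ hφ using hfactors
  let y : ∀ i, X i := fun i => Classical.arbitrary (X i)
  have hmul : ∀ i g h, φ (g * h) i = φ g i * φ h i := fun i g h => by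
    ext p
    have := hφ (g * h) (WithLp.toLp 2 (Function.update y i p)) i
    rw [mul_smul, hφ, hφ] at this
    simpa using this.symm
  -- The spaces of a hierarchically hyperbolic structure live in `Type`; a separable space is
  -- isometric to a subspace of `ℓ^∞(ℕ, ℝ)`.
  let e : ∀ i, X i ≃ᵢ range (kuratowskiEmbedding (X i)) := fun i =>
    (kuratowskiEmbedding.isometry (X i)).isometryEquivOnRange
  let a : ∀ i, Γ →* (range (kuratowskiEmbedding (X i)) ≃ᵢ range (kuratowskiEmbedding (X i))) :=
    fun i => MonoidHom.mk' (fun g => (e i).symm.trans ((φ g i).trans (e i))) fun g h => by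
      ext p
      simp [hmul]
  have hdist : ∀ (p q : ∀ i, X i), dist (fun i => e i (p i)) (fun i => e i (q i)) = dist p q :=
    fun p q => by simp only [dist_pi_def, nndist, IsometryEquiv.dist_eq]
  have ha : ∀ g, (fun i => a i g (e i (y i))) = fun i => e i ((g • WithLp.toLp 2 y) i) :=
    fun g => by
      ext1 i
      simp [a, hφ]
  obtain ⟨K, hK, hKX⟩ := hcocompact
  obtain ⟨R, hR⟩ := (hK.image (PiLp.continuous_ofLp 2 X)).isBounded.subset_closedBall y
  refine isHHG_of_isHyperbolicSpace_factors _ a (fun i => e i (y i)) (δ := 2) (R := R)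
    (fun i => (hcat i).isHyperbolicSpace.of_isometryEquiv (e i)) (fun r => ?_) fun z => ?_
  · refine (ProperlyDiscontinuousSMul.finite_disjoint_inter_image (Γ := Γ)
      (isCompact_singleton (x := WithLp.toLp 2 y))
      ((isCompact_closedBall y r).image (PiLp.continuous_toLp 2 X))).subset fun g hg => ?_
    refine ⟨g • WithLp.toLp 2 y, ⟨_, rfl, rfl⟩, (g • WithLp.toLp 2 y).ofLp, ?_, rfl⟩
    rw [mem_ofPred_eq, ha, hdist] at hg
    rwa [Metric.mem_closedBall, dist_comm]
  · obtain ⟨g, k, hk, hgk⟩ := hKX (WithLp.toLp 2 fun i => (e i).symm (z i))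
    refine ⟨g, ?_⟩
    have hz : z = fun i => e i ((g • k) i) := by
      ext1 i
      simp [hgk]
    rw [ha, hz, hdist, dist_comm]
    have h1 : dist k.ofLp y ≤ R := hR (mem_image_of_mem _ hk)
    refine le_trans (le_of_eq ?_) h1
    simp only [dist_pi_def, nndist, hφ, IsometryEquiv.dist_eq]
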